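/- Let $R$ be a commutative artinian ring and let $\mathcal C$ be a dualizing Krull--Schmidt $R$-variety: $\mathcal C$ is a skeletally small additive $R$-linear category with split idempotents, every object of $\mathcal C$ is a finite direct sum of objects with local endomorphism ring, every $R$-module $\mathcal C(X,Y)$ is finitely generated, and $D=\mathrm{Hom}_R(-,I(R/r))$ (with $r$ the Jacobson radical of $R$ and $I(R/r)$ the injective envelope of $R/r$) restricts to a duality between $\mathcal A=\mathrm{mod}(\mathcal C)$, the category of finitely presented contravariant functors from $\mathcal C$ to $R$-modules, and $\mathrm{mod}(\mathcal C^{op})$. Then $\mathcal A$ is abelian. Let $C^-(\mathcal A)$ be the category of bounded above complexes $\cdots\to K_{i+1}\to K_i\to K_{i-1}\to\cdots$ in $\mathcal A$ (that is, $K_i=0$ for $i\ll 0$), with the exact structure $\mathcal S$ consisting of the short exact sequences that split in each degree. Let $P^0(\mathcal A)\subset C^-(\mathcal A)$ be the full subcategory of complexes of projectives $\cdots\to P_2\to P_1\to P_0\to 0$ with zero homology except in degree $0$, and for such a complex put $\Theta(P_\bullet)=\mathrm{Coker}(P_1\to P_0)$. Let $P_\bullet,Q_\bullet\in P^0(\mathcal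 A)$ have no nonzero direct summand of the form $$\cdots\to T_3\oplus T_2\xrightarrow{\left(\begin{smallmatrix}0&1\\0&0\end{smallmatrix}\right)}T_2\oplus T_1\xrightarrow{\left(\begin{smallmatrix}0&1\\0&0\end{smallmatrix}\right)}T_1\oplus T_0\to 0$$ with all $T_i$ projective in $\mathcal A$. Then for every integer $k\ge 1$ there is an isomorphism of $R$-modules $$\mathrm{Ext}^k_{C^-(\mathcal A)}(P_\bullet,Q_\bullet)\cong\mathrm{Ext}^k_{\mathcal A}(\Theta(P_\bullet),\Theta(Q_\bullet)),$$ where $\mathrm{Ext}^k_{C^-(\mathcal A)}$ is the relative Ext of the exact category $(C^-(\mathcal A),\mathcal S)$: $P_\bullet$ has an $\mathcal S$-exact resolution by $\mathcal S$-projective objects, and $\mathrm{Ext}^k_{C^-(\mathcal A)}(P_\bullet,Q_\bullet)$ is the $k$-th cohomology of $\mathrm{Hom}_{C^-(\mathcal A)}(-,Q_\bullet)$ applied to any such resolution. -/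

import Mathlib

open CategoryTheory CategoryTheory.Limits CategoryTheory.Abelian Opposite

universe w v u

noncomputable section

/-! ### Finitely presented functors -/

section FinitelyPresented

/-- Given a functor `h : B ⥤ F` (in practice the Yoneda embedding of `B`), the objects `M` of `F`
for which there is an exact sequence `h X ⟶ h Y ⟶ M ⟶ 0`. -/
def IsPresentedBy {B : Type*} [Category* B] {F : Type*} [Category* F] [Preadditive F]
    (h : B ⥤ F) : ObjectProperty F := fun M =>
  ∃ (X Y : B) (f : X ⟶ Y) (p : h.obj Y ⟶ M) (w : h.map f ≫ p = 0),
    (ShortComplex.mk (h.map f) p w).Exact ∧ Epi p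

variable (R : Type v) [CommRing R] (C : Type u) [Category.{v} C] [Preadditive C] [Linear R C]

/-- The finitely presented contravariant functors from `C` to `R`-modules:
there is an exact sequence `C(-, X) ⟶ C(-, Y) ⟶ M ⟶ 0`. -/
abbrev isFP : ObjectProperty (Cᵒᵖ ⥤ ModuleCat.{v} R) := IsPresentedBy (linearYoneda R C)

/-- The finitely presented covariant functors from `C` to `R`-modules, that is,
the finitely presented contravariant functors on `Cᵒᵖ`:
there is an exact sequence `C(X, -) ⟶ C(Y, -) ⟶ M ⟶ 0`. -/
abbrev isFPOp : ObjectProperty (C ⥤ ModuleCat.{v} R) := IsPresentedBy (linearCoyoneda R C)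

/-- The category `mod(C)` of finitely presented contravariant functors on `C`. -/
abbrev FPMod := (isFP R C).FullSubcategory

/-- The category `mod(Cᵒᵖ)`. -/
abbrev FPModOp := (isFPOp R C).FullSubcategory

end FinitelyPresented

/-! ### Dualizing Krull-Schmidt varieties -/

section Dualizing

/-- `E` is an injective envelope of `R/r`, where `r` is the Jacobson radical of `R`:
it is injective and `R/r` embeds in it as an essential submodule. -/
def IsInjectiveEnvelopeOfTop (R : Type v) [CommRing R] (E : ModuleCat.{v} R) : Prop :=
  Injective E ∧ ∃ ι : (R ⧸ Ideal.jacobson (⊥ : Ideal R)) →ₗ[R] E,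
    Function.Injective ι ∧ ∀ N : Submodule R E, N ⊓ LinearMap.range ι = ⊥ → N = ⊥

variable (R : Type v) [CommRing R] (C : Type u) [Category.{v} C]

/-- The contravariant functor `D` sending `M : Cᵒᵖ ⥤ Mod R` to the functor
`X ↦ Hom_R(M(X), E)`. -/
def dualFunctor (E : ModuleCat.{v} R) :
    (Cᵒᵖ ⥤ ModuleCat.{v} R)ᵒᵖ ⥤ (C ⥤ ModuleCat.{v} R) where
  obj M := M.unop.rightOp ⋙ (linearYoneda R (ModuleCat.{v} R)).obj E
  map f := Functor.whiskerRight (NatTrans.rightOp f.unop)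
    ((linearYoneda R (ModuleCat.{v} R)).obj E)

/-- `C` is a dualizing `R`-category: it is Hom-finite, and `D = Hom_R(-, I(R/r))` restricts to a
duality (contravariant equivalence) between `mod(C)` and `mod(Cᵒᵖ)`. -/
class IsDualizing [Preadditive C] [Linear R C] : Prop where
  hom_finite (X Y : C) : Module.Finite R (X ⟶ Y)
  exists_duality : ∃ (E : ModuleCat.{v} R), IsInjectiveEnvelopeOfTop R E ∧
    ∃ h : ∀ M : (FPMod R C)ᵒᵖ, isFPOp R C (((isFP R C).ι.op ⋙ dualFunctor R C E).obj M),
      ((isFPOp R C).lift ((isFP R C).ι.op ⋙ dualFunctor R C E) h).IsEquivalence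

/-- Every object is a finite direct sum of objects with local endomorphism ring. -/
class IsKrullSchmidt [Preadditive C] [HasFiniteBiproducts C] : Prop where
  exists_decomposition (X : C) : ∃ (n : ℕ) (Y : Fin n → C),
    (∀ i, IsLocalRing (End (Y i))) ∧ Nonempty (X ≅ ⨁ Y)

end Dualizing

/-! ### `mod(C)` is abelian for dualizing `C` -/

section AbelianMod

namespace IsPresentedBy

variable {B : Type*} [Category* B] {F : Type*} [Category* F] [Abelian F] {h : B ⥤ F}

lemma closedUnderCokernels [Preadditive B] [HasBinaryBiproducts B] [h.Additive]
    (hlift : ∀ {X Y : B} {M : F} (p : h.obj Y ⟶ M) [Epi p] (g : h.obj X ⟶ M),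
      ∃ b : X ⟶ Y, h.map b ≫ p = g) :
    (IsPresentedBy h).IsClosedUnderCokernels where
  cokernels_le := by
    rintro _ ⟨f, k, hk, ⟨X, Y, a, p, w, he, hp⟩, ⟨X', Y', a', p', w', he', hp'⟩⟩
    obtain ⟨b, hb'⟩ := hlift p' (p ≫ f)
    have hkepi : Epi k.π := Cofork.IsColimit.epi hk
    have hw : h.map (biprod.desc b a') ≫ (p' ≫ k.π) = 0 := by
      have h1 : biprod.desc b a' = biprod.fst ≫ b + biprod.snd ≫ a' := by
        rw [biprod.desc_eq]
      rw [h1, h.map_add, h.map_comp, h.map_comp, Preadditive.add_comp, Category.assoc,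
        Category.assoc, reassoc_of% hb', reassoc_of% w', k.condition]
      simp
    refine ⟨Y ⊞ X', Y', biprod.desc b a', p' ≫ k.π, hw, ?_, epi_comp _ _⟩
    apply ShortComplex.exact_of_g_is_cokernel
    refine CokernelCofork.IsColimit.ofπ' _ _ (fun {T} t ht => ?_)
    have e1 : h.map b ≫ t = 0 := by
      have := congrArg (fun z => h.map biprod.inl ≫ z) ht
      simpa [← Functor.map_comp_assoc] using this
    have e2 : h.map a' ≫ t = 0 := by
      have := congrArg (fun z => h.map biprod.inr ≫ z) ht
      simpa [← Functor.map_comp_assoc] using this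
    have hc := he'.gIsCokernel
    let t' := hc.desc (CokernelCofork.ofπ t e2)
    have ht' : p' ≫ t' = t := hc.fac (CokernelCofork.ofπ t e2) WalkingParallelPair.one
    have e3 : f ≫ t' = 0 := by
      rw [← cancel_epi p, ← reassoc_of% hb', ht', e1, comp_zero]
    let t'' := hk.desc (CokernelCofork.ofπ t' e3)
    have ht'' : k.π ≫ t'' = t' := hk.fac (CokernelCofork.ofπ t' e3) WalkingParallelPair.one
    exact ⟨t'', by rw [Category.assoc, ht'', ht']⟩

lemma of_iso {M N : F} (e : M ≅ N) (hM : IsPresentedBy h M) : IsPresentedBy h N := by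
  obtain ⟨X, Y, f, p, w, he, hp⟩ := hM
  refine ⟨X, Y, f, p ≫ e.hom, by rw [reassoc_of% w, zero_comp], ?_, epi_comp _ _⟩
  let φ : ShortComplex.mk (h.map f) p w ≅
      ShortComplex.mk (h.map f) (p ≫ e.hom) (by rw [reassoc_of% w, zero_comp]) :=
    ShortComplex.isoMk (Iso.refl _) (Iso.refl _) e
  exact ShortComplex.exact_of_iso φ he

instance : (IsPresentedBy h).IsClosedUnderIsomorphisms where
  of_iso e hM := of_iso e hM

open ZeroObject in
lemma obj [Preadditive B] [HasZeroObject B] [h.Additive] (X : B) : IsPresentedBy h (h.obj X) := by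
  refine ⟨0, X, 0, 𝟙 _, by simp, ?_, inferInstance⟩
  apply ShortComplex.exact_of_g_is_cokernel
  exact CokernelCofork.IsColimit.ofπ' _ _ (fun {T} t _ => ⟨t, by simp⟩)

open ZeroObject in
lemma closedUnderFiniteProducts [Preadditive B] [HasBinaryBiproducts B] [HasZeroObject B]
    [h.Additive] : (IsPresentedBy h).IsClosedUnderFiniteProducts := by
  have : (IsPresentedBy h).ContainsZero :=
    ⟨h.obj 0, h.map_isZero (isZero_zero B), obj 0⟩
  have : (IsPresentedBy h).IsClosedUnderBinaryProducts := by
    have key : ∀ M N : F, IsPresentedBy h M → IsPresentedBy h N → IsPresentedBy h (M ⊞ N) := by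
      rintro M N ⟨X, Y, f, p, w, he, hp⟩ ⟨X', Y', f', p', w', he', hp'⟩
      have hc := he.gIsCokernel
      have hc' := he'.gIsCokernel
      have i1 : h.map biprod.inl ≫ (h.map biprod.fst ≫ p ≫ biprod.inl +
          h.map biprod.snd ≫ p' ≫ biprod.inr : h.obj (Y ⊞ Y') ⟶ M ⊞ N) = p ≫ biprod.inl := by
        simp [← Functor.map_comp_assoc]
      have i2 : h.map biprod.inr ≫ (h.map biprod.fst ≫ p ≫ biprod.inl +
          h.map biprod.snd ≫ p' ≫ biprod.inr : h.obj (Y ⊞ Y') ⟶ M ⊞ N) = p' ≫ biprod.inr := by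
        simp [← Functor.map_comp_assoc]
      have hepi : Epi (h.map biprod.fst ≫ p ≫ biprod.inl +
          h.map biprod.snd ≫ p' ≫ biprod.inr : h.obj (Y ⊞ Y') ⟶ M ⊞ N) := by
        refine Preadditive.epi_of_cancel_zero _ (fun t ht => ?_)
        apply biprod.hom_ext'
        · rw [← cancel_epi p, ← reassoc_of% i1, ht]
          simp only [comp_zero]
        · rw [← cancel_epi p', ← reassoc_of% i2, ht]
          simp only [comp_zero]
      refine ⟨X ⊞ X', Y ⊞ Y', biprod.map f f',
        h.map biprod.fst ≫ p ≫ biprod.inl + h.map biprod.snd ≫ p' ≫ biprod.inr, ?_, ?_, ?_⟩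
      · rw [Preadditive.comp_add, ← h.map_comp_assoc, ← h.map_comp_assoc, biprod.map_fst,
          biprod.map_snd, h.map_comp, h.map_comp, Category.assoc, Category.assoc,
          reassoc_of% w, reassoc_of% w']
        simp
      · apply ShortComplex.exact_of_g_is_cokernel
        refine CokernelCofork.IsColimit.ofπ' _ _ (fun {T} t ht => ?_)
        have e1 : h.map f ≫ h.map biprod.inl ≫ t = 0 := by
          rw [← h.map_comp_assoc, ← biprod.inl_map f f', h.map_comp_assoc, ht, comp_zero]
        have e2 : h.map f' ≫ h.map biprod.inr ≫ t = 0 := by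
          rw [← h.map_comp_assoc, ← biprod.inr_map f f', h.map_comp_assoc, ht, comp_zero]
        let s := hc.desc (CokernelCofork.ofπ _ e1)
        have hs : p ≫ s = h.map biprod.inl ≫ t :=
          hc.fac (CokernelCofork.ofπ _ e1) WalkingParallelPair.one
        let s' := hc'.desc (CokernelCofork.ofπ _ e2)
        have hs' : p' ≫ s' = h.map biprod.inr ≫ t :=
          hc'.fac (CokernelCofork.ofπ _ e2) WalkingParallelPair.one
        refine ⟨biprod.desc s s', ?_⟩
        simp only [Preadditive.add_comp, Category.assoc, biprod.inl_desc, biprod.inr_desc, hs, hs']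
        rw [← h.map_comp_assoc, ← h.map_comp_assoc, ← Preadditive.add_comp, ← h.map_add,
          biprod.total, h.map_id, Category.id_comp]
      · exact hepi
    refine ⟨?_⟩
    rintro _ ⟨pr⟩
    have hb : (IsPresentedBy h) (pr.diag.obj ⟨.left⟩ ⊞ pr.diag.obj ⟨.right⟩) :=
      key _ _ (pr.prop_diag_obj _) (pr.prop_diag_obj _)
    have e : pr.diag ≅ pair (pr.diag.obj ⟨.left⟩) (pr.diag.obj ⟨.right⟩) := diagramIsoPair _
    exact of_iso (IsLimit.conePointsIsoOfNatIso (BinaryBiproduct.isLimit _ _) pr.isLimit e.symm) hb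
  exact ObjectProperty.IsClosedUnderFiniteProducts.mk'

end IsPresentedBy

variable (R : Type v) [CommRing R] (C : Type u) [Category.{v} C] [Preadditive C] [Linear R C]

instance : (linearYoneda R C).Additive where
  map_add {X Y f g} := by
    ext ⟨Z⟩ (z : Z ⟶ X)
    exact Preadditive.comp_add _ _ _ z f g

instance : (linearCoyoneda R C).Additive where
  map_add {X Y f g} := by
    ext Z (z : X.unop ⟶ Z)
    exact Preadditive.add_comp _ _ _ f.unop g.unop z

variable {R C}

lemma linearYoneda_hom_apply {X : C} {M : Cᵒᵖ ⥤ ModuleCat.{v} R}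
    (g : (linearYoneda R C).obj X ⟶ M) {Z : C} (z : Z ⟶ X) :
    g.app (op Z) z = M.map z.op (g.app (op X) (𝟙 X)) := by
  have := ConcreteCategory.congr_hom (g.naturality z.op) (𝟙 X)
  exact (congrArg (g.app (op Z)) (Category.comp_id z)).symm.trans this

lemma linearYoneda_hom_ext {X : C} {M : Cᵒᵖ ⥤ ModuleCat.{v} R}
    {g g' : (linearYoneda R C).obj X ⟶ M}
    (hg : g.app (op X) (𝟙 X) = g'.app (op X) (𝟙 X)) : g = g' := by
  ext ⟨Z⟩ z
  exact (linearYoneda_hom_apply g z).trans ((congrArg _ hg).trans (linearYoneda_hom_apply g' z).symm)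

lemma linearCoyoneda_hom_apply {X : C} {M : C ⥤ ModuleCat.{v} R}
    (g : (linearCoyoneda R C).obj (op X) ⟶ M) {Z : C} (z : X ⟶ Z) :
    g.app Z z = M.map z (g.app X (𝟙 X)) := by
  have := ConcreteCategory.congr_hom (g.naturality z) (𝟙 X)
  exact (congrArg (g.app Z) (Category.id_comp z)).symm.trans this

lemma linearCoyoneda_hom_ext {X : C} {M : C ⥤ ModuleCat.{v} R}
    {g g' : (linearCoyoneda R C).obj (op X) ⟶ M}
    (hg : g.app X (𝟙 X) = g'.app X (𝟙 X)) : g = g' := by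
  ext Z z
  exact (linearCoyoneda_hom_apply g z).trans
    ((congrArg _ hg).trans (linearCoyoneda_hom_apply g' z).symm)

lemma app_surjective {J : Type*} [Category* J] {M N : J ⥤ ModuleCat.{v} R} (p : M ⟶ N) [Epi p]
    (j : J) : Function.Surjective (p.app j) :=
  (ModuleCat.epi_iff_surjective _).1 inferInstance

lemma app_injective {J : Type*} [Category* J] {M N : J ⥤ ModuleCat.{v} R} (p : M ⟶ N) [Mono p]
    (j : J) : Function.Injective (p.app j) :=
  (ModuleCat.mono_iff_injective _).1 inferInstance

lemma linearYoneda_lift {X Y : C} {M : Cᵒᵖ ⥤ ModuleCat.{v} R}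
    (p : (linearYoneda R C).obj Y ⟶ M) [Epi p] (g : (linearYoneda R C).obj X ⟶ M) :
    ∃ b : X ⟶ Y, (linearYoneda R C).map b ≫ p = g := by
  obtain ⟨b, hb⟩ := app_surjective p (op X) (g.app (op X) (𝟙 X))
  refine ⟨b, linearYoneda_hom_ext ?_⟩
  rw [← hb]
  exact congrArg (p.app (op X)) (Category.id_comp (X := X) (Y := Y) b)

lemma linearCoyoneda_lift {X Y : Cᵒᵖ} {M : C ⥤ ModuleCat.{v} R}
    (p : (linearCoyoneda R C).obj Y ⟶ M) [Epi p] (g : (linearCoyoneda R C).obj X ⟶ M) :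
    ∃ b : X ⟶ Y, (linearCoyoneda R C).map b ≫ p = g := by
  obtain ⟨b, hb⟩ := app_surjective p X.unop (g.app X.unop (𝟙 X.unop))
  refine ⟨Quiver.Hom.op b, linearCoyoneda_hom_ext (X := X.unop) ?_⟩
  rw [← hb]
  exact congrArg (p.app X.unop) (Category.comp_id (X := Y.unop) (Y := X.unop) b)

variable [HasFiniteBiproducts C]

instance : (isFP R C).ContainsZero :=
  ⟨_, (linearYoneda R C).map_isZero (isZero_zero C), IsPresentedBy.obj _⟩

instance : (isFP R C).IsClosedUnderFiniteProducts :=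
  have := hasBinaryBiproducts_of_finite_biproducts C
  IsPresentedBy.closedUnderFiniteProducts

instance : (isFP R C).IsClosedUnderCokernels :=
  have := hasBinaryBiproducts_of_finite_biproducts C
  IsPresentedBy.closedUnderCokernels linearYoneda_lift

instance : (isFPOp R C).IsClosedUnderCokernels :=
  have := hasBinaryBiproducts_of_finite_biproducts C
  have : HasBinaryBiproducts Cᵒᵖ := HasBinaryBiproducts.of_hasBinaryProducts
  IsPresentedBy.closedUnderCokernels linearCoyoneda_lift

lemma isFP_closedUnderKernels [HasKernels (FPMod R C)] : (isFP R C).IsClosedUnderKernels where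
  kernels_le := by
    rintro _ ⟨f, k, hk, hM, hN⟩
    let M' : FPMod R C := ⟨_, hM⟩
    let N' : FPMod R C := ⟨_, hN⟩
    let f' : M' ⟶ N' := ObjectProperty.homMk f
    let K := kernel f'
    let κ : K.obj ⟶ M'.obj := (kernel.ι f').hom
    have hκ : κ ≫ f = 0 := congrArg (fun g => g.hom) (kernel.condition f')
    let φ : K.obj ⟶ k.pt := hk.lift (KernelFork.ofι κ hκ)
    have hφ : φ ≫ k.ι = κ := hk.fac (KernelFork.ofι κ hκ) WalkingParallelPair.zero
    have : Mono k.ι := Fork.IsLimit.mono hk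
    have hφa (X : Cᵒᵖ) (y : K.obj.obj X) : k.ι.app X (φ.app X y) = κ.app X y := by
      rw [← hφ]; rfl
    have hbij (X : Cᵒᵖ) : Function.Bijective (φ.app X) := by
      constructor
      · rw [injective_iff_map_eq_zero]
        intro y hy
        obtain ⟨_, Z, _, q, _, _, hq⟩ := K.property
        obtain ⟨z, rfl⟩ := app_surjective q X y
        let z' : X.unop ⟶ Z := z
        let L : FPMod R C := ⟨_, IsPresentedBy.obj (h := linearYoneda R C) X.unop⟩
        let c : L ⟶ K := ObjectProperty.homMk ((linearYoneda R C).map z' ≫ q)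
        have hcid : c.hom.app X (𝟙 X.unop) = q.app X z := by
          exact congrArg (q.app X) (Category.id_comp z')
        have hc : c ≫ kernel.ι f' = 0 := by
          apply ObjectProperty.hom_ext
          apply linearYoneda_hom_ext
          change κ.app X (c.hom.app X (𝟙 X.unop)) = 0
          rw [hcid, ← hφa, hy, map_zero]
        have hc0 : c = 0 := (cancel_mono (kernel.ι f')).1 (by rw [hc, zero_comp])
        rw [← hcid, hc0]
        rfl
      · intro x
        obtain ⟨_, Y, _, p, _, _, hp⟩ := hM
        obtain ⟨b, hb⟩ := app_surjective p X (k.ι.app X x)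
        let b' : X.unop ⟶ Y := b
        let L : FPMod R C := ⟨_, IsPresentedBy.obj (h := linearYoneda R C) X.unop⟩
        let g : L ⟶ M' := ObjectProperty.homMk ((linearYoneda R C).map b' ≫ p)
        have hgid : g.hom.app X (𝟙 X.unop) = k.ι.app X x := by
          rw [← hb]
          exact congrArg (p.app X) (Category.id_comp b')
        have hg : g ≫ f' = 0 := by
          apply ObjectProperty.hom_ext
          apply linearYoneda_hom_ext
          change f.app X (g.hom.app X (𝟙 X.unop)) = 0
          rw [hgid]
          have := ConcreteCategory.congr_hom (NatTrans.congr_app k.condition X) x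
          exact this
        refine ⟨(kernel.lift f' g hg).hom.app X (𝟙 X.unop), app_injective k.ι X ?_⟩
        rw [hφa, ← hgid]
        conv_rhs => rw [← kernel.lift_ι f' g hg]
        rfl
    have : ∀ X, IsIso (φ.app X) := fun X =>
      (ConcreteCategory.isIso_iff_bijective (φ.app X)).2 (hbij X)
    have : IsIso φ := NatIso.isIso_of_isIso_app φ
    exact IsPresentedBy.of_iso (asIso φ) K.property

instance [IsDualizing R C] : HasKernels (FPMod R C) := by
  obtain ⟨E, _, h, hE⟩ := IsDualizing.exists_duality (R := R) (C := C)
  have : HasCoequalizers (FPModOp R C) := Preadditive.hasCoequalizers_of_hasCokernels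
  have : HasColimitsOfShape WalkingParallelPair (FPMod R C)ᵒᵖ :=
    Adjunction.hasColimitsOfShape_of_equivalence
      ((isFPOp R C).lift ((isFP R C).ι.op ⋙ dualFunctor R C E) h)
  have : HasColimitsOfShape WalkingParallelPairᵒᵖ (FPMod R C)ᵒᵖ :=
    hasColimitsOfShape_of_equivalence walkingParallelPairOpEquiv
  have : HasEqualizers (FPMod R C) := hasLimitsOfShape_of_hasColimitsOfShape_op
  infer_instance

instance [IsDualizing R C] : (isFP R C).IsClosedUnderKernels := isFP_closedUnderKernels

instance [IsDualizing R C] : HasExt.{max u (v + 1)} (FPMod R C) := HasExt.standard _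

end AbelianMod

/-! ### Relative homological algebra -/

section Relative

variable {B : Type*} [Category* B] [Preadditive B]

/-- `P` is projective relative to the class `S` of short exact sequences. -/
def IsRelProjective (S : ObjectProperty (ShortComplex B)) (P : B) : Prop :=
  ∀ T : ShortComplex B, S T → ∀ f : P ⟶ T.X₃, ∃ g : P ⟶ T.X₂, g ≫ T.g = f

/-- A resolution `⋯ ⟶ P₁ ⟶ P₀ ⟶ X ⟶ 0` of `X` by relative projective objects, such that all the
sequences `0 ⟶ Im dᵢ₊₁ ⟶ Pᵢ ⟶ Im dᵢ ⟶ 0` belong to `S`. The object `syz i` is `Im dᵢ`,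
with `syz 0 = X`, and the differential `Pᵢ₊₁ ⟶ Pᵢ` is the composition
`Pᵢ₊₁ ⟶ syz (i + 1) ⟶ Pᵢ`. -/
structure RelProjResolution (S : ObjectProperty (ShortComplex B)) (X : B) where
  complex : ChainComplex B ℕ
  isRelProjective (i : ℕ) : IsRelProjective S (complex.X i)
  syz : ℕ → B
  syzZeroIso : syz 0 ≅ X
  ι (i : ℕ) : syz (i + 1) ⟶ complex.X i
  π (i : ℕ) : complex.X i ⟶ syz i
  π_ι (i : ℕ) : π (i + 1) ≫ ι i = complex.d (i + 1) i
  ι_π (i : ℕ) : ι i ≫ π i = 0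
  mem (i : ℕ) : S (ShortComplex.mk (ι i) (π i) (ι_π i))

/-- The relative Ext-module `Ext^k_S(X, Y)`: the value on `X` of the `k`-th right derived functor
of `Hom(-, Y)`, computed by the relative projective resolution `T` of `X`, that is, the `k`-th
cohomology of `0 ⟶ Hom(P₀, Y) ⟶ Hom(P₁, Y) ⟶ ⋯`. -/
def relExt (R : Type*) [Ring R] [Linear R B] {S : ObjectProperty (ShortComplex B)} {X : B}
    (T : RelProjResolution S X) (Y : B) (k : ℕ) : ModuleCat R :=
  ((((linearYoneda R B).obj Y).rightOp.mapHomologicalComplex _).obj T.complex).unop.homology k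

end Relative

/-! ### Bounded above complexes and projective resolutions -/

section Complexes

variable (A : Type*) [Category* A] [Abelian A]

/-- The category `C⁻(A)` of bounded above cochain complexes. A complex
`⋯ ⟶ P₁ ⟶ P₀ ⟶ 0` written homologically has `Pₖ` in cohomological degree `-k`. -/
abbrev CMinus := ObjectProperty.FullSubcategory
  (fun K : CochainComplex A ℤ => ∃ n : ℤ, K.IsStrictlyLE n)

/-- The exact structure on `C⁻(A)`: the sequences `0 ⟶ L ⟶ M ⟶ N ⟶ 0` which are
split exact in each degree. -/
def degreewiseSplit : ObjectProperty (ShortComplex (CMinus A)) := fun S =>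
  ∀ n : ℤ, Nonempty
    (S.map (ObjectProperty.ι _ ⋙ HomologicalComplex.eval A (ComplexShape.up ℤ) n)).Splitting

/-- The category `P⁰(A)` of projective resolutions: complexes of projectives
`⋯ ⟶ P₁ ⟶ P₀ ⟶ 0` that are exact except in degree `0`. -/
abbrev PZero := ObjectProperty.FullSubcategory (fun K : CMinus A =>
  (∀ n : ℤ, Projective (K.obj.X n)) ∧ (∀ n : ℤ, 0 < n → IsZero (K.obj.X n)) ∧
    ∀ n : ℤ, n ≠ 0 → K.obj.ExactAt n)

variable {A}

/-- The functor `Θ` on objects: it sends `⋯ ⟶ P₁ ⟶ P₀ ⟶ 0` to the cokernel of `P₁ ⟶ P₀`. -/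
abbrev Theta (P : PZero A) : A := cokernel (P.obj.obj.d (-1) 0)

/-- The complexes of the form
`⋯ ⟶ P₃ ⊞ P₂ ⟶ P₂ ⊞ P₁ ⟶ P₁ ⊞ P₀ ⟶ 0`, with all `Pₖ` projective, the term `Pₖ₊₁ ⊞ Pₖ` being in
homological degree `k`, and with differentials given by the matrix `[0, 1; 0, 0]`. -/
def IsStandardRelProjective (K : CMinus A) : Prop :=
  ∃ (P : ℕ → A) (e : ∀ k : ℕ, K.obj.X (-(k : ℤ)) ≅ P (k + 1) ⊞ P k),
    (∀ k, Projective (P k)) ∧ (∀ n : ℤ, 0 < n → IsZero (K.obj.X n)) ∧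
    ∀ k : ℕ, K.obj.d (-((k + 1 : ℕ) : ℤ)) (-(k : ℤ)) =
      (e (k + 1)).hom ≫ biprod.snd ≫ biprod.inl ≫ (e k).inv

/-- `K` has no nonzero direct summand of the form
`⋯ ⟶ P₃ ⊞ P₂ ⟶ P₂ ⊞ P₁ ⟶ P₁ ⊞ P₀ ⟶ 0`. -/
def HasNoRelProjectiveSummand (K : CMinus A) : Prop :=
  ∀ L : CMinus A, IsStandardRelProjective L → Nonempty (Retract L K) → IsZero L

end Complexes

end

/-! In $(C^-(\mathcal A),\mathcal S)$ the relative projectives are exactly the contractible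
complexes: null-homotopic maps lift along degreewise split epimorphisms, and every complex is a
quotient of a contractible cone with kernel $X[-1]$. This yields a resolution (`coneResolution`).
For any resolution, $\mathrm{Ext}^k$ with $k\ge 1$ is $\mathrm{Hom}$ from the $k$-th syzygy to $Q$
modulo maps extending to a contractible complex, i.e. modulo null-homotopic maps
(`nonempty_relExt_linearEquiv_hom`). The $k$-th syzygy is $P[-k]$ up to homotopy
(`nonempty_iso_syz_shift`), so $\mathrm{Ext}^k$ is $\mathrm{Hom}_{K(\mathcal A)}(P,Q[k])$. As $P$ is
K-projective, this is $\mathrm{Hom}_{D(\mathcal A)}(P,Q[k])$, and $P$, $Q$ are isomorphic in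
$D(\mathcal A)$ to $\Theta(P)$, $\Theta(Q)$ placed in degree $0$
(`nonempty_hom_shift_linearEquiv_ext`). -/

noncomputable section

/-! ### Relative projectives, cones and degreewise split sequences -/

section DegreewiseSplit

variable {A : Type*} [Category* A] [Abelian A]

open CochainComplex HomologicalComplex Pretriangulated

/-- A morphism of complexes lifts along a degreewise split epimorphism if it is null-homotopic. -/
lemma exists_lift_of_homotopy_zero {K L M : CochainComplex A ℤ} (f : K ⟶ M) (h : Homotopy f 0)
    (p : L ⟶ M) (s : ∀ n, M.X n ⟶ L.X n) (hs : ∀ n, s n ≫ p.f n = 𝟙 _) :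
    ∃ g : K ⟶ L, g ≫ p = f := by
  -- The sections `s` need not commute with differentials; composing them with the homotopy still
  -- produces a chain map $dhs+hsd$, which `p` sends to $dh+hd=f$.
  refine ⟨Homotopy.nullHomotopicMap fun i j => h.hom i j ≫ s j, ?_⟩
  rw [Homotopy.nullHomotopicMap_comp]
  ext n
  simp [Homotopy.nullHomotopicMap, hs, h.comm n]

/-- A morphism of complexes extends along a degreewise split monomorphism if it is
null-homotopic. -/
lemma exists_extension_of_homotopy_zero {K L M : CochainComplex A ℤ} (f : K ⟶ M)
    (h : Homotopy f 0) (i : K ⟶ L) (r : ∀ n, L.X n ⟶ K.X n) (hr : ∀ n, i.f n ≫ r n = 𝟙 _) :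
    ∃ g : L ⟶ M, i ≫ g = f := by
  refine ⟨Homotopy.nullHomotopicMap fun a b => r a ≫ h.hom a b, ?_⟩
  rw [Homotopy.comp_nullHomotopicMap]
  ext n
  simp [Homotopy.nullHomotopicMap, reassoc_of% hr, h.comm n]

/-- The image in the homotopy category of a bounded above complex. -/
abbrev CMinus.toHomotopy (A : Type*) [Category* A] [Abelian A] :
    CMinus A ⥤ HomotopyCategory A (ComplexShape.up ℤ) :=
  ObjectProperty.ι _ ⋙ HomotopyCategory.quotient A (ComplexShape.up ℤ)

lemma isZero_quotient_obj_iff (K : CochainComplex A ℤ) :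
    IsZero ((HomotopyCategory.quotient A (ComplexShape.up ℤ)).obj K) ↔
      Nonempty (Homotopy (𝟙 K) 0) := by
  rw [IsZero.iff_id_eq_zero]
  constructor
  · intro h
    exact ⟨HomotopyCategory.homotopyOfEq _ _ (by simpa using h)⟩
  · rintro ⟨h⟩
    simpa using HomotopyCategory.eq_of_homotopy _ _ h

/-- A contraction of `K` makes every map out of `K` null-homotopic, hence liftable. -/
lemma isRelProjective_of_isZero (K : CMinus A) (hK : IsZero ((CMinus.toHomotopy A).obj K)) :
    IsRelProjective (degreewiseSplit A) K := by
  intro T hT f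
  obtain ⟨h⟩ := (isZero_quotient_obj_iff _).1 hK
  obtain ⟨g, hg⟩ := exists_lift_of_homotopy_zero f.hom
    ((Homotopy.ofEq (Category.id_comp f.hom).symm).trans
      ((h.compRight f.hom).trans (Homotopy.ofEq zero_comp)))
    T.g.hom (fun n => (hT n).some.s) (fun n => (hT n).some.s_g)
  exact ⟨ObjectProperty.homMk g, ObjectProperty.hom_ext _ hg⟩

/-- The cone is $K^{i+1}\oplus L^i$ in degree $i$, whence the bound `n + 1` on `K`. -/
lemma isStrictlyLE_mappingCone {K L : CochainComplex A ℤ} (φ : K ⟶ L) (n : ℤ)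
    [K.IsStrictlyLE (n + 1)] [L.IsStrictlyLE n] : (mappingCone φ).IsStrictlyLE n := by
  rw [isStrictlyLE_iff]
  intro i hi
  rw [IsZero.iff_id_eq_zero, mappingCone.ext_to_iff φ i (i + 1) rfl]
  exact ⟨(K.isZero_of_isStrictlyLE (n + 1) _ (by lia)).eq_of_tgt _ _,
    (L.isZero_of_isStrictlyLE n _ hi).eq_of_tgt _ _⟩

namespace CMinus

/-- The shift `X[-1]` of a bounded above complex. -/
def shiftDown (X : CMinus A) : CMinus A :=
  ⟨X.obj⟦(-1 : ℤ)⟧, by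
    obtain ⟨n, hn⟩ := X.property
    exact ⟨n + 1, X.obj.isStrictlyLE_shift n _ _ (by lia)⟩⟩

/-- The cone of the identity of `X[-1]`. -/
def cone (X : CMinus A) : CMinus A :=
  ⟨mappingCone (𝟙 X.shiftDown.obj), by
    obtain ⟨n, hn⟩ := X.shiftDown.property
    have : X.shiftDown.obj.IsStrictlyLE (n + 1) := isStrictlyLE_of_le _ n _ (by lia)
    exact ⟨n, isStrictlyLE_mappingCone _ n⟩⟩

/-- The inclusion of `X[-1]` in the cone of its identity. -/
def coneι (X : CMinus A) : X.shiftDown ⟶ X.cone :=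
  ObjectProperty.homMk (mappingCone.inr (𝟙 X.shiftDown.obj))

/-- The projection of the cone of the identity of `X[-1]` onto `X`. -/
def coneπ (X : CMinus A) : X.cone ⟶ X :=
  ObjectProperty.homMk ((mappingCone.triangle (𝟙 X.shiftDown.obj)).mor₃ ≫
    (shiftEquiv (CochainComplex A ℤ) (1 : ℤ)).counitIso.hom.app X.obj)

lemma coneι_coneπ (X : CMinus A) : X.coneι ≫ X.coneπ = 0 := by
  apply ObjectProperty.hom_ext
  exact (mappingCone.inr_triangleδ_assoc (𝟙 X.shiftDown.obj) _).trans zero_comp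

lemma degreewiseSplit_cone (X : CMinus A) :
    degreewiseSplit A (ShortComplex.mk X.coneι X.coneπ X.coneι_coneπ) := by
  intro n
  -- The standard split sequence of a mapping cone ends in $X[-1][1]$; only this last term has to be
  -- identified with $X$.
  let e : (mappingCone.triangleRotateShortComplex (𝟙 X.shiftDown.obj)).map (eval A _ n) ≅
      (ShortComplex.mk X.coneι X.coneπ X.coneι_coneπ).map
        (ObjectProperty.ι _ ⋙ HomologicalComplex.eval A (ComplexShape.up ℤ) n) :=
    ShortComplex.isoMk (Iso.refl _) (Iso.refl _)
      ((HomologicalComplex.eval A _ n).mapIso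
        ((shiftEquiv (CochainComplex A ℤ) (1 : ℤ)).counitIso.app X.obj))
      ((Category.id_comp _).trans (Category.comp_id _).symm) (Category.id_comp _)
  exact ⟨(mappingCone.triangleRotateShortComplexSplitting (𝟙 X.shiftDown.obj) n).ofIso e⟩

lemma isZero_cone (X : CMinus A) : IsZero ((toHomotopy A).obj X.cone) := by
  have h := HomotopyCategory.mappingCone_triangleh_distinguished (𝟙 X.shiftDown.obj)
  refine (Triangle.isZero₃_iff_isIso₁ _ h).2 ?_
  exact Functor.map_isIso (HomotopyCategory.quotient A (ComplexShape.up ℤ)) (𝟙 X.shiftDown.obj)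

/-- The composition of the projection of a cone with the inclusion in the next one. -/
def coneD (X : CMinus A) : X.shiftDown.cone ⟶ X.cone := X.shiftDown.coneπ ≫ X.coneι

lemma coneD_coneD (X : CMinus A) : X.shiftDown.coneD ≫ X.coneD = 0 := by
  simp only [coneD, Category.assoc]
  rw [← Category.assoc X.shiftDown.coneι, coneι_coneπ, zero_comp, comp_zero]

/-- The iterated shift `X[-n]` of a bounded above complex. -/
def iterShiftDown (X : CMinus A) : ℕ → CMinus A
  | 0 => X
  | n + 1 => (X.iterShiftDown n).shiftDown

/-- The resolution of `X` by cones of identities. -/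
def coneResolution (X : CMinus A) : RelProjResolution (degreewiseSplit A) X where
  complex := ChainComplex.of (fun i => (X.iterShiftDown i).cone)
    (fun i => (X.iterShiftDown i).coneD) fun i => (X.iterShiftDown i).coneD_coneD
  isRelProjective _ := isRelProjective_of_isZero _ (isZero_cone _)
  syz := X.iterShiftDown
  syzZeroIso := Iso.refl _
  ι i := (X.iterShiftDown i).coneι
  π i := (X.iterShiftDown i).coneπ
  π_ι i := (ChainComplex.of_d (fun i => (X.iterShiftDown i).cone)
    (fun i => (X.iterShiftDown i).coneD) i).symm
  ι_π _ := coneι_coneπ _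
  mem _ := degreewiseSplit_cone _

end CMinus

/-- The identity of a relative projective lifts to its cone, so it factors through a contractible
complex. -/
lemma isZero_of_isRelProjective (K : CMinus A) (hK : IsRelProjective (degreewiseSplit A) K) :
    IsZero ((CMinus.toHomotopy A).obj K) := by
  obtain ⟨g, hg⟩ := hK _ K.degreewiseSplit_cone (𝟙 K)
  rw [IsZero.iff_id_eq_zero, ← CategoryTheory.Functor.map_id, ← hg, Functor.map_comp,
    K.isZero_cone.eq_of_tgt ((CMinus.toHomotopy A).map g) 0, zero_comp]

/-- A degreewise split sequence gives a distinguished triangle; if its middle term vanishes, the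
connecting map is invertible. -/
lemma nonempty_iso_shift (S : ShortComplex (CMinus A)) (hS : degreewiseSplit A S)
    (h : IsZero ((CMinus.toHomotopy A).obj S.X₂)) :
    Nonempty ((CMinus.toHomotopy A).obj S.X₃ ≅ ((CMinus.toHomotopy A).obj S.X₁)⟦(1 : ℤ)⟧) := by
  let S' := S.map (ObjectProperty.ι _)
  let σ : ∀ n, (S'.map (HomologicalComplex.eval A _ n)).Splitting := fun n => (hS n).some
  have hT := (HomotopyCategory.distinguished_iff_iso_trianglehOfDegreewiseSplit
    (trianglehOfDegreewiseSplit S' σ)).2 ⟨S', σ, ⟨Iso.refl _⟩⟩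
  exact ⟨@asIso _ _ _ _ _ ((Triangle.isZero₂_iff_isIso₃ _ hT).1 h)⟩

end DegreewiseSplit

/-! ### Relative Ext as a quotient of morphisms from a syzygy -/

section RelExt

/-- Presents homology as a quotient of any module mapping onto the cycles. -/
lemma ModuleCat.exists_linearMap_homology {R : Type*} [Ring R] (S : ShortComplex (ModuleCat R))
    {M : Type*} [AddCommGroup M] [Module R M] (a : M →ₗ[R] S.X₂)
    (ha : LinearMap.range a = LinearMap.ker S.g.hom) :
    ∃ Ψ : M →ₗ[R] S.homology, Function.Surjective Ψ ∧
      ∀ m, Ψ m = 0 ↔ ∃ x : S.X₁, S.f x = a m := by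
  have h (m) : a m ∈ LinearMap.ker S.g.hom := ha ▸ LinearMap.mem_range_self a m
  refine ⟨S.moduleCatHomologyIso.toLinearEquiv.symm.toLinearMap ∘ₗ
    (LinearMap.range S.moduleCatToCycles).mkQ ∘ₗ a.codRestrict _ h, ?_, fun m => ?_⟩
  · refine S.moduleCatHomologyIso.toLinearEquiv.symm.surjective.comp
      ((Submodule.mkQ_surjective _).comp ?_)
    rintro ⟨x, hx⟩
    obtain ⟨m, rfl⟩ := ha ▸ hx
    exact ⟨m, rfl⟩
  · rw [LinearMap.comp_apply, LinearEquiv.coe_coe, LinearEquiv.map_eq_zero_iff]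
    refine (Submodule.Quotient.mk_eq_zero (LinearMap.range S.moduleCatToCycles)).trans ?_
    exact exists_congr fun x => Subtype.ext_iff

variable {B : Type*} [Category* B] [Preadditive B] (R : Type*) [Ring R] [Linear R B]
  {S : ObjectProperty (ShortComplex B)} {X : B}

/-- If the sequences in `S` are short exact, then `Ext^{k+1}_S(X, Y)` is the quotient of the
morphisms from the syzygy of index `k + 1` to `Y` by those extending to the projective
object of index `k`. -/
lemma relExt_exists_linearMap (T : RelProjResolution S X) (Y : B)
    (hepi : ∀ U : ShortComplex B, S U → Epi U.g)
    (hdesc : ∀ U : ShortComplex B, S U → ∀ f : U.X₂ ⟶ Y, U.f ≫ f = 0 → ∃ g, U.g ≫ g = f)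
    (k : ℕ) :
    ∃ Ψ : (T.syz (k + 1) ⟶ Y) →ₗ[R] relExt R T Y (k + 1), Function.Surjective Ψ ∧
      ∀ f, Ψ f = 0 ↔ ∃ g, T.ι k ≫ g = f := by
  have e1 := hepi _ (T.mem (k + 1))
  have e2 := hepi _ (T.mem (k + 2))
  dsimp at e1 e2
  let K := ((((linearYoneda R B).obj Y).rightOp.mapHomologicalComplex _).obj T.complex).unop
  have hprev : (ComplexShape.down ℕ).symm.prev (k + 1) = k :=
    ComplexShape.prev_eq' _ (by simp)
  have hnext : (ComplexShape.down ℕ).symm.next (k + 1) = k + 2 :=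
    ComplexShape.next_eq' _ (by simp)
  let e : relExt R T Y (k + 1) ≅ (K.sc' k (k + 1) (k + 2)).homology :=
    ShortComplex.homologyMapIso (K.isoSc' k (k + 1) (k + 2) hprev hnext)
  -- Cocycles in degree `k + 1` are the maps that kill the next syzygy, hence factor through `T.π (k
  -- + 1)`.
  let a : (T.syz (k + 1) ⟶ Y) →ₗ[R] (K.sc' k (k + 1) (k + 2)).X₂ :=
    Linear.leftComp R Y (T.π (k + 1))
  have ha : LinearMap.range a = LinearMap.ker (K.sc' k (k + 1) (k + 2)).g.hom := by
    ext (f : T.complex.X (k + 1) ⟶ Y)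
    change (∃ g, T.π (k + 1) ≫ g = f) ↔ T.complex.d (k + 2) (k + 1) ≫ f = 0
    rw [← T.π_ι (k + 1)]
    constructor
    · rintro ⟨g, rfl⟩
      rw [Category.assoc, reassoc_of% (T.ι_π (k + 1)), zero_comp, comp_zero]
    · intro hf
      refine hdesc _ (T.mem (k + 1)) f ?_
      rw [← cancel_epi (T.π (k + 2)), ← Category.assoc, hf, comp_zero]
  obtain ⟨Ψ, h1, h2⟩ := ModuleCat.exists_linearMap_homology _ a ha
  refine ⟨e.toLinearEquiv.symm.toLinearMap ∘ₗ Ψ, e.toLinearEquiv.symm.surjective.comp h1,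
    fun f => ?_⟩
  simp only [LinearMap.comp_apply, LinearEquiv.coe_coe, LinearEquiv.map_eq_zero_iff, h2]
  -- Being a coboundary becomes extension along `T.ι k` once the epimorphism `T.π (k + 1)` is
  -- cancelled.
  change (∃ g, T.complex.d (k + 1) k ≫ g = T.π (k + 1) ≫ f) ↔ _
  simp only [← T.π_ι, Category.assoc, cancel_epi]

end RelExt

/-! ### Passage to the homotopy and derived categories -/

section Derived

variable {A : Type u} [Category.{v} A] [Abelian A]

open CochainComplex HomologicalComplex

lemma degreewiseSplit.epi {U : ShortComplex (CMinus A)} (hU : degreewiseSplit A U) : Epi U.g := by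
  refine ⟨fun f g h => ?_⟩
  ext n
  have : Epi (U.g.hom.f n) := (hU n).some.epi_g
  rw [← cancel_epi (U.g.hom.f n)]
  exact congrArg (fun φ => φ.hom.f n) h

/-- Degreewise exactness makes `U.g` a cokernel among all complexes, and $C^-(\mathcal A)$ is a full
subcategory. -/
lemma degreewiseSplit.exists_desc {U : ShortComplex (CMinus A)} (hU : degreewiseSplit A U)
    {Y : CMinus A} (f : U.X₂ ⟶ Y) (hf : U.f ≫ f = 0) : ∃ g, U.g ≫ g = f := by
  let S' := U.map (ObjectProperty.ι _)
  have hS' : S'.Exact := HomologicalComplex.exact_of_degreewise_exact _ fun n =>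
    (hU n).some.exact
  have : Epi S'.g := HomologicalComplex.epi_of_epi_f _ fun n => (hU n).some.epi_g
  obtain ⟨g, hg⟩ := CokernelCofork.IsColimit.desc' hS'.gIsCokernel f.hom
    (congrArg (fun φ => φ.hom) hf)
  exact ⟨ObjectProperty.homMk g, ObjectProperty.hom_ext _ hg⟩

/-- Null-homotopic maps extend by means of the degreewise retractions; conversely, an extension
factors `f` through a contractible complex. -/
lemma toHomotopy_map_eq_zero_iff {U : ShortComplex (CMinus A)} (hU : degreewiseSplit A U)
    (h : IsZero ((CMinus.toHomotopy A).obj U.X₂)) {Y : CMinus A} (f : U.X₁ ⟶ Y) :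
    (CMinus.toHomotopy A).map f = 0 ↔ ∃ g, U.f ≫ g = f := by
  constructor
  · intro hf
    obtain ⟨g, hg⟩ := exists_extension_of_homotopy_zero f.hom
      (HomotopyCategory.homotopyOfEq _ _ (hf.trans (Functor.map_zero _ _ _).symm))
      U.f.hom (fun n => (hU n).some.r) (fun n => (hU n).some.f_r)
    exact ⟨ObjectProperty.homMk g, ObjectProperty.hom_ext _ hg⟩
  · rintro ⟨g, rfl⟩
    rw [Functor.map_comp, h.eq_of_src ((CMinus.toHomotopy A).map g) 0, comp_zero]

variable (R : Type*) [Ring R] [Linear R A]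

/-- The relative Ext in positive degrees consists of the homotopy classes of morphisms from
the syzygy. -/
lemma nonempty_relExt_linearEquiv_hom {X : CMinus A}
    (T : RelProjResolution (degreewiseSplit A) X) (Y : CMinus A) (k : ℕ) :
    Nonempty (relExt R T Y (k + 1) ≃ₗ[R]
      ((CMinus.toHomotopy A).obj (T.syz (k + 1)) ⟶ (CMinus.toHomotopy A).obj Y)) := by
  obtain ⟨Ψ, h1, h2⟩ := relExt_exists_linearMap R T Y (fun _ h => h.epi)
    (fun _ h f hf => h.exists_desc f hf) k
  let Φ := (CMinus.toHomotopy A).mapLinearMap R (X := T.syz (k + 1)) (Y := Y)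
  have hΦ : Function.Surjective Φ := (CMinus.toHomotopy A).map_surjective
  -- Relative Ext and homotopy classes are both quotients of the maps `T.syz (k + 1) ⟶ Y`, so
  -- comparing kernels suffices.
  have hker : LinearMap.ker Ψ = LinearMap.ker Φ := by
    ext f
    rw [LinearMap.mem_ker, LinearMap.mem_ker, h2]
    exact (toHomotopy_map_eq_zero_iff (T.mem k)
      (isZero_of_isRelProjective _ (T.isRelProjective k)) f).symm
  exact ⟨(Ψ.quotKerEquivOfSurjective h1).symm ≪≫ₗ Submodule.quotEquivOfEq _ _ hker ≪≫ₗ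
    Φ.quotKerEquivOfSurjective hΦ⟩

lemma nonempty_iso_syz_shift {X : CMinus A} (T : RelProjResolution (degreewiseSplit A) X)
    (k : ℕ) : Nonempty (((CMinus.toHomotopy A).obj (T.syz k))⟦(k : ℤ)⟧ ≅
      (CMinus.toHomotopy A).obj X) := by
  induction k with
  | zero => exact ⟨(shiftFunctorZero _ ℤ).app _ ≪≫ (CMinus.toHomotopy A).mapIso T.syzZeroIso⟩
  | succ k ih =>
    obtain ⟨e⟩ := ih
    obtain ⟨e'⟩ := nonempty_iso_shift _ (T.mem k)
      (isZero_of_isRelProjective _ (T.isRelProjective k))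
    exact ⟨(CategoryTheory.shiftFunctorAdd' _ (1 : ℤ) (k : ℤ) ((k + 1 : ℕ) : ℤ) (by lia)).app _ ≪≫
      (CategoryTheory.shiftFunctor _ (k : ℤ)).mapIso e'.symm ≪≫ e⟩

/-- A complex with homology only in degree `0` and zero in positive degrees is isomorphic in the
derived category to the cokernel of its last differential. -/
lemma nonempty_iso_singleFunctor [HasDerivedCategory.{w} A] (K : CochainComplex A ℤ)
    (hK : ∀ n : ℤ, 0 < n → IsZero (K.X n)) (hK' : ∀ n : ℤ, n ≠ 0 → K.ExactAt n) :
    Nonempty (DerivedCategory.Q.obj K ≅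
      (DerivedCategory.singleFunctor A 0).obj (cokernel (K.d (-1) 0))) := by
  have h (n : ℤ) (hn : n ≠ 0) :
      IsZero ((DerivedCategory.homologyFunctor A n).obj (DerivedCategory.Q.obj K)) :=
    ((exactAt_iff_isZero_homology _ _).1 (hK' n hn)).of_iso
      ((DerivedCategory.homologyFunctorFactors A n).app K)
  have : (DerivedCategory.Q.obj K).IsGE 0 :=
    (DerivedCategory.isGE_iff _ _).2 fun i hi => h i (by lia)
  have : (DerivedCategory.Q.obj K).IsLE 0 :=
    (DerivedCategory.isLE_iff _ _).2 fun i hi => h i (by lia)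
  obtain ⟨Y, ⟨e⟩⟩ :=
    DerivedCategory.exists_iso_singleFunctor_obj_of_isGE_of_isLE (DerivedCategory.Q.obj K) 0
  -- The differential out of degree $0$ vanishes because $K^1=0$, so $H^0$ is the whole cokernel.
  let e₁ : K.homology 0 ≅ cokernel (K.d (-1) 0) :=
    K.isoHomologyι 0 1 (by simp) ((hK 1 (by lia)).eq_of_tgt _ _) ≪≫
      (K.opcyclesIsCokernel (-1) 0 (by simp)).coconePointUniqueUpToIso (colimit.isColimit _)
  let e₂ : Y ≅ K.homology 0 :=
    ((DerivedCategory.singleFunctorCompHomologyFunctorIso A 0).app Y).symm ≪≫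
      (DerivedCategory.homologyFunctor A 0).mapIso e.symm ≪≫
      (DerivedCategory.homologyFunctorFactors A 0).app K
  exact ⟨e ≪≫ (DerivedCategory.singleFunctor A 0).mapIso (e₂ ≪≫ e₁)⟩

lemma PZero.isKProjective (P : PZero A) : P.obj.obj.IsKProjective := by
  obtain ⟨d, hd⟩ := P.obj.property
  have := P.property.1
  exact CochainComplex.isKProjective_of_projective _ d

/-- The homotopy classes of morphisms from `P` to `Q[k]` identify to the `Ext`-module. -/
lemma nonempty_hom_shift_linearEquiv_ext [HasExt.{w} A] (P Q : PZero A) (k : ℕ) :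
    Nonempty (((CMinus.toHomotopy A).obj P.obj ⟶ ((CMinus.toHomotopy A).obj Q.obj)⟦(k : ℤ)⟧) ≃ₗ[R]
      Ext (Theta P) (Theta Q) k) := by
  let := HasDerivedCategory.standard A
  have := P.isKProjective
  obtain ⟨eP⟩ := nonempty_iso_singleFunctor _ P.property.2.1 P.property.2.2
  obtain ⟨eQ⟩ := nonempty_iso_singleFunctor _ Q.property.2.1 Q.property.2.2
  -- K-projectivity of the source alone makes localization bijective on these morphisms.
  let e₁ := LinearEquiv.ofBijective (DerivedCategory.Qh.mapLinearMap R
      (X := (CMinus.toHomotopy A).obj P.obj) (Y := ((CMinus.toHomotopy A).obj Q.obj)⟦(k : ℤ)⟧))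
    (IsKProjective.Qh_map_bijective P.obj.obj _)
  let fP := (DerivedCategory.quotientCompQhIso A).app P.obj.obj ≪≫ eP
  let fQ := (DerivedCategory.Qh.commShiftIso (k : ℤ)).app ((CMinus.toHomotopy A).obj Q.obj) ≪≫
    (CategoryTheory.shiftFunctor _ (k : ℤ)).mapIso ((DerivedCategory.quotientCompQhIso A).app Q.obj.obj ≪≫ eQ)
  exact ⟨e₁ ≪≫ₗ Linear.homCongr R fP fQ ≪≫ₗ Ext.homLinearEquiv.symm⟩

/-- The relative Ext of projective resolutions in positive degrees. -/
theorem nonempty_relExt_linearEquiv_ext [HasExt.{w} A] (P Q : PZero A)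
    (T : RelProjResolution (degreewiseSplit A) P.obj) (k : ℕ) (hk : 1 ≤ k) :
    Nonempty (relExt R T Q.obj k ≃ₗ[R] Ext (Theta P) (Theta Q) k) := by
  -- Positivity of the degree supplies the preceding projective term, through which the
  -- null-homotopic maps from the syzygy factor.
  obtain ⟨k, rfl⟩ := Nat.exists_eq_add_of_le' hk
  obtain ⟨e₁⟩ := nonempty_relExt_linearEquiv_hom R T Q.obj k
  obtain ⟨i⟩ := nonempty_iso_syz_shift T (k + 1)
  obtain ⟨e₃⟩ := nonempty_hom_shift_linearEquiv_ext R P Q (k + 1)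
  let F := CategoryTheory.shiftFunctor (HomotopyCategory A (ComplexShape.up ℤ)) ((k + 1 : ℕ) : ℤ)
  let e₂ := LinearEquiv.ofBijective (F.mapLinearMap R
      (X := (CMinus.toHomotopy A).obj (T.syz (k + 1))) (Y := (CMinus.toHomotopy A).obj Q.obj))
    ⟨F.map_injective, F.map_surjective⟩
  exact ⟨e₁ ≪≫ₗ e₂ ≪≫ₗ Linear.homCongr R i (Iso.refl _) ≪≫ₗ e₃⟩

end Derived

end

theorem mainTheorem9 {R : Type v} [CommRing R] [IsArtinianRing R]
    {C : Type u} [Category.{v} C] [Preadditive C] [Linear R C]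
    [EssentiallySmall.{v} C] [HasFiniteBiproducts C] [IsIdempotentComplete C]
    [IsKrullSchmidt C] [IsDualizing R C]
    (P Q : PZero (FPMod R C))
    (hP : HasNoRelProjectiveSummand P.obj) (hQ : HasNoRelProjectiveSummand Q.obj) :
    Nonempty (RelProjResolution (degreewiseSplit (FPMod R C)) P.obj) ∧
    ∀ (T : RelProjResolution (degreewiseSplit (FPMod R C)) P.obj) (k : ℕ), 1 ≤ k →
      Nonempty (relExt R T Q.obj k ≃ₗ[R] Ext (Theta P) (Theta Q) k) :=
  ⟨⟨P.obj.coneResolution⟩, fun T k hk => nonempty_relExt_linearEquiv_ext R P Q T k hk⟩
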